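/- Let $q_i(x)=x^\top A_i x+2b_i^\top x+c_i$ ($i=1,2$) be quadratic functions on $\mathbb{R}^n$, with $A_i$ real symmetric $n\times n$ matrices, $b_i\in\mathbb{R}^n$ and $c_i\in\mathbb{R}$. For $\gamma\in\mathbb{R}^2$ put $A[\gamma]=\gamma_1A_1+\gamma_2A_2$, $b[\gamma]=\gamma_1b_1+\gamma_2b_2$ and $[\gamma,q(x)]=\gamma_1q_1(x)+\gamma_2q_2(x)$. Let $$\Gamma_1=\{\gamma\in\mathbb{R}^2_+:\ A[\gamma]\succeq 0\},\qquad \hat{\mathcal S}=\{x\in\mathbb{R}^n:\ q_1(x)\le 0,\ q_2(x)\le 0\},$$ $$\hat{\mathcal S}_{\mathrm{SDP}}=\{x\in\mathbb{R}^n:\ \exists X\succeq xx^\top,\ \langle A_i,X\rangle+2b_i^\top x+c_i\le 0 \text{ for } i=1,2\}.$$ Suppose there exists $\hat\gamma\in\mathbb{R}^2_+$ such that $A[\hat\gamma]\succ 0$, and let $\gamma^{(1)},\gamma^{(2)}\in\mathbb{R}^2_+$ be generators of $\Gamma_1$, that is, $\Gamma_1=\operatorname{cone}(\{\gamma^{(1)},\gamma^{(2)}\})$.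 A subspace of $\mathbb{R}^n$ is called nontrivial if it is not $\{0\}$. (a) $\operatorname{conv}(\hat{\mathcal S})=\hat{\mathcal S}_{\mathrm{SDP}}$ if and only if, for both $(i,j)=(1,2)$ and $(i,j)=(2,1)$, the following holds: if both coordinates of $\gamma^{(i)}$ are positive and there exists $x\in\mathbb{R}^n$ with $[\gamma^{(i)},q(x)]=0$ and $[\gamma^{(j)},q(x)]<0$, then $\ker(A[\gamma^{(i)}])\cap b[\gamma^{(i)}]^\perp$ is nontrivial. (b) If, in addition, $q_1$ and $q_2$ are both nonconvex and there exists $\hat x\in\mathbb{R}^n$ with $q_1(\hat x)<0$ and $q_2(\hat x)<0$, then $\operatorname{conv}(\hat{\mathcal S})=\hat{\mathcal S}_{\mathrm{SDP}}$ if and only if $\ker(A[\gamma^{(i)}])\cap b[\gamma^{(i)}]^\perp$ is nontrivial for both $i=1,2$. -/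

import Mathlib

open scoped Matrix

/-- A (not necessarily homogeneous) real quadratic function `x ↦ xᵀ A x + 2 bᵀ x + c` on `ℝⁿ`,
given by its data: a symmetric matrix `A`, a vector `b` and a constant `c`. -/
structure QuadFun (n : ℕ) where
  A : Matrix (Fin n) (Fin n) ℝ
  symm : A.IsSymm
  b : Fin n → ℝ
  c : ℝ

namespace QuadFun

variable {n : ℕ}

/-- The value `xᵀ A x + 2 bᵀ x + c`. -/
def eval (p : QuadFun n) (x : Fin n → ℝ) : ℝ :=
  x ⬝ᵥ (p.A *ᵥ x) + 2 * (p.b ⬝ᵥ x) + p.c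

/-- The lifted constraint function `⟨A, X⟩ + 2 bᵀ x + c`, with `⟨A, X⟩ = tr (Aᵀ X)`. -/
def lift (p : QuadFun n) (X : Matrix (Fin n) (Fin n) ℝ) (x : Fin n → ℝ) : ℝ :=
  (p.Aᵀ * X).trace + 2 * (p.b ⬝ᵥ x) + p.c

/-- The aggregated matrix `A[γ] = γ₁ A₁ + γ₂ A₂` (the objective function being `0`). -/
def aggA (q : Fin 2 → QuadFun n) (γ : Fin 2 → ℝ) : Matrix (Fin n) (Fin n) ℝ :=
  ∑ i, γ i • (q i).A

/-- The aggregated vector `b[γ] = γ₁ b₁ + γ₂ b₂`. -/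
def aggb (q : Fin 2 → QuadFun n) (γ : Fin 2 → ℝ) : Fin n → ℝ :=
  ∑ i, γ i • (q i).b

/-- The aggregated value `[γ, q(x)] = γ₁ q₁(x) + γ₂ q₂(x)`. -/
def aggEval (q : Fin 2 → QuadFun n) (γ : Fin 2 → ℝ) (x : Fin n → ℝ) : ℝ :=
  ∑ i, γ i * (q i).eval x

/-- `Γ₁ = {γ ∈ ℝ²₊ : A[γ] ⪰ 0}`. -/
def Gamma1 (q : Fin 2 → QuadFun n) : Set (Fin 2 → ℝ) :=
  {γ | (∀ k, 0 ≤ γ k) ∧ (aggA q γ).PosSemidef}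

/-- `Ŝ = {x : q₁(x) ≤ 0, q₂(x) ≤ 0}`. -/
def feasibleSet (q : Fin 2 → QuadFun n) : Set (Fin n → ℝ) :=
  {x | ∀ i, (q i).eval x ≤ 0}

/-- The projected SDP relaxation
`Ŝ_SDP = {x : ∃ X ⪰ x xᵀ, ⟨Aᵢ, X⟩ + 2 bᵢᵀ x + cᵢ ≤ 0 for i = 1, 2}`. -/
def sdpSet (q : Fin 2 → QuadFun n) : Set (Fin n → ℝ) :=
  {x | ∃ X : Matrix (Fin n) (Fin n) ℝ,
    (X - Matrix.vecMulVec x x).PosSemidef ∧ ∀ i, (q i).lift X x ≤ 0}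

/-- `ker(A[γ]) ∩ b[γ]^⊥`. -/
def kerPerp (q : Fin 2 → QuadFun n) (γ : Fin 2 → ℝ) : Set (Fin n → ℝ) :=
  {y | aggA q γ *ᵥ y = 0 ∧ aggb q γ ⬝ᵥ y = 0}

end QuadFun

/-! Perturbing a positive definite aggregation shows that `Γ₁` has nonempty interior, so its
generators are independent (`det_ne_zero`). A generator with positive coordinates has a singular
matrix (`exists_ker`), and the other aggregation is strictly curved on that kernel (`quad_pos`).
Rank-one lifts along such directions, with slack for a generator on an axis, show that the
relaxation is exactly where both aggregated convex functions are nonpositive (`mem_sdpSet_iff`).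

Sufficiency: from a relaxed point violating one constraint, move both ways along a kernel direction.
The violated function is strictly concave there and reaches zero on both sides at feasible points,
so the original point lies between them.

Necessity: if `kerPerp` is trivial, a point with one aggregation zero and the other negative is
extreme in the relaxation. Exactness would make it feasible, hence a common zero of both
constraints, which is absurd. -/

/-- A positive definite matrix stays positive semidefinite under small symmetric perturbations. -/
theorem Matrix.PosDef.exists_posSemidef_add_smul {n : ℕ} {A B : Matrix (Fin n) (Fin n) ℝ}
    (hA : A.PosDef) (hB : B.IsSymm) :
    ∃ δ : ℝ, 0 < δ ∧ ∀ ε : ℝ, 0 ≤ ε → ε ≤ δ → (A + ε • B).PosSemidef := by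
  have hcont : Continuous fun z : ℝ × (Fin n → ℝ) ↦ z.2 ⬝ᵥ ((A + z.1 • B) *ᵥ z.2) := by fun_prop
  have hev : ∀ᶠ ε in nhds (0 : ℝ), ∀ x ∈ Metric.sphere (0 : Fin n → ℝ) 1,
      0 < x ⬝ᵥ ((A + ε • B) *ᵥ x) := by
    refine (isCompact_sphere (0 : Fin n → ℝ) 1).eventually_forall_of_forall_eventually ?_
    intro x hx
    refine hcont.continuousAt.eventually (lt_mem_nhds ?_)
    have hx0 : x ≠ 0 := by
      rintro rfl
      simp at hx
    simpa using hA.dotProduct_mulVec_pos hx0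
  obtain ⟨δ, hδ, h⟩ := Metric.eventually_nhds_iff.1 hev
  refine ⟨δ / 2, by positivity, fun ε hε0 hε ↦ ?_⟩
  have hAs : A.IsSymm := by simpa using hA.isHermitian
  refine Matrix.PosSemidef.of_dotProduct_mulVec_nonneg ?_ fun x ↦ ?_
  · rw [Matrix.IsHermitian, Matrix.conjTranspose_eq_transpose_of_trivial]
    exact hAs.add (hB.smul ε)
  · rcases eq_or_ne x 0 with rfl | hx
    · simp
    have hn : 0 < ‖x‖ := norm_pos_iff.2 hx
    have hd : dist ε 0 < δ := by
      rw [Real.dist_eq, sub_zero, abs_of_nonneg hε0]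
      linarith
    have h1 := h hd (‖x‖⁻¹ • x) (by simp [norm_smul, hn.ne'])
    rw [Matrix.mulVec_smul, dotProduct_smul, smul_dotProduct, smul_eq_mul, smul_eq_mul] at h1
    have h2 : 0 < ‖x‖⁻¹ := by positivity
    rw [star_trivial]
    exact ((mul_pos_iff_of_pos_left h2).1 ((mul_pos_iff_of_pos_left h2).1 h1)).le

open scoped MatrixOrder in
/-- The trace of a product of two real positive semidefinite matrices is nonnegative. -/
theorem Matrix.PosSemidef.trace_mul_nonneg {n : ℕ} {A B : Matrix (Fin n) (Fin n) ℝ}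
    (hA : A.PosSemidef) (hB : B.PosSemidef) : 0 ≤ (A * B).trace := by
  obtain ⟨C, rfl⟩ := CStarAlgebra.nonneg_iff_eq_star_mul_self.1 hB.nonneg
  rw [Matrix.star_eq_conjTranspose, ← Matrix.mul_assoc, Matrix.trace_mul_comm, ← Matrix.mul_assoc]
  exact (hA.mul_mul_conjTranspose_same C).trace_nonneg

/-! ### Aggregation, restriction to lines, convexity -/

namespace QuadFun

variable {n : ℕ}

/-- The aggregated quadratic function `γ₁ q₁ + γ₂ q₂`. -/
def agg (q : Fin 2 → QuadFun n) (γ : Fin 2 → ℝ) : QuadFun n where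
  A := aggA q γ
  symm := by
    simp only [aggA, Fin.sum_univ_two]
    exact ((q 0).symm.smul _).add ((q 1).symm.smul _)
  b := aggb q γ
  c := ∑ i, γ i * (q i).c

theorem eval_agg (q : Fin 2 → QuadFun n) (γ : Fin 2 → ℝ) (x : Fin n → ℝ) :
    (agg q γ).eval x = aggEval q γ x := by
  simp only [eval, agg, aggA, aggb, aggEval, Fin.sum_univ_two, Matrix.add_mulVec,
    Matrix.smul_mulVec, dotProduct_add, add_dotProduct, dotProduct_smul, smul_dotProduct,
    smul_eq_mul]
  ring

theorem dotProduct_aggA_mulVec (q : Fin 2 → QuadFun n) (γ : Fin 2 → ℝ) (y : Fin n → ℝ) :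
    y ⬝ᵥ (aggA q γ *ᵥ y) = γ 0 * (y ⬝ᵥ ((q 0).A *ᵥ y)) + γ 1 * (y ⬝ᵥ ((q 1).A *ᵥ y)) := by
  simp only [aggA, Fin.sum_univ_two, Matrix.add_mulVec, Matrix.smul_mulVec, dotProduct_add,
    dotProduct_smul, smul_eq_mul]

theorem aggEval_eq (q : Fin 2 → QuadFun n) (γ : Fin 2 → ℝ) (x : Fin n → ℝ) :
    aggEval q γ x = γ 0 * (q 0).eval x + γ 1 * (q 1).eval x := by
  simp [aggEval]

theorem aggA_add (q : Fin 2 → QuadFun n) (γ δ : Fin 2 → ℝ) :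
    aggA q (γ + δ) = aggA q γ + aggA q δ := by
  simp only [aggA, Fin.sum_univ_two, Pi.add_apply, add_smul]
  abel

theorem aggA_smul (q : Fin 2 → QuadFun n) (t : ℝ) (γ : Fin 2 → ℝ) :
    aggA q (t • γ) = t • aggA q γ := by
  simp only [aggA, Fin.sum_univ_two, Pi.smul_apply, smul_add, smul_smul, smul_eq_mul]

theorem dotProduct_mulVec_symm (p : QuadFun n) (x y : Fin n → ℝ) :
    x ⬝ᵥ (p.A *ᵥ y) = y ⬝ᵥ (p.A *ᵥ x) := by
  rw [Matrix.dotProduct_mulVec, ← Matrix.mulVec_transpose, p.symm.eq, dotProduct_comm]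

/-- Restriction of a quadratic function to a line. -/
theorem eval_add_smul (p : QuadFun n) (x y : Fin n → ℝ) (t : ℝ) :
    p.eval (x + t • y) =
      p.eval x + t * (2 * (x ⬝ᵥ (p.A *ᵥ y) + p.b ⬝ᵥ y)) + t ^ 2 * (y ⬝ᵥ (p.A *ᵥ y)) := by
  simp only [eval, Matrix.mulVec_add, Matrix.mulVec_smul, dotProduct_add, add_dotProduct,
    dotProduct_smul, smul_dotProduct, smul_eq_mul]
  rw [p.dotProduct_mulVec_symm y x]
  ring

theorem eval_add_smul_of_mulVec_eq_zero (p : QuadFun n) (x : Fin n → ℝ) {y : Fin n → ℝ}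
    (hy : p.A *ᵥ y = 0) (t : ℝ) : p.eval (x + t • y) = p.eval x + t * (2 * (p.b ⬝ᵥ y)) := by
  rw [eval_add_smul, hy]
  simp

/-- The convexity defect of a quadratic function along a segment. -/
theorem eval_convexCombo (p : QuadFun n) (x y : Fin n → ℝ) {a b : ℝ} (hab : a + b = 1) :
    p.eval (a • x + b • y) =
      a * p.eval x + b * p.eval y - a * b * ((x - y) ⬝ᵥ (p.A *ᵥ (x - y))) := by
  obtain rfl : b = 1 - a := by linarith
  simp only [eval, Matrix.mulVec_add, Matrix.mulVec_sub, Matrix.mulVec_smul, dotProduct_add,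
    dotProduct_sub, sub_dotProduct, add_dotProduct, dotProduct_smul, smul_dotProduct, smul_eq_mul]
  rw [p.dotProduct_mulVec_symm y x]
  ring

theorem convexOn_eval (p : QuadFun n) (hp : p.A.PosSemidef) : ConvexOn ℝ Set.univ p.eval := by
  refine ⟨convex_univ, fun x _ y _ a b ha hb hab ↦ ?_⟩
  rw [p.eval_convexCombo x y hab, smul_eq_mul, smul_eq_mul]
  have h := hp.dotProduct_mulVec_nonneg (x - y)
  rw [star_trivial] at h
  have := mul_nonneg (mul_nonneg ha hb) h
  linarith

/-- `⟨A, Y + x xᵀ⟩ + 2 bᵀ x + c = ⟨A, Y⟩ + q(x)`. -/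
theorem lift_add_vecMulVec (p : QuadFun n) (Y : Matrix (Fin n) (Fin n) ℝ) (x : Fin n → ℝ) :
    p.lift (Y + Matrix.vecMulVec x x) x = (p.A * Y).trace + p.eval x := by
  rw [lift, eval, p.symm.eq, Matrix.mul_add, Matrix.trace_add, Matrix.mul_vecMulVec,
    Matrix.trace_vecMulVec, dotProduct_comm x]
  ring

theorem trace_mul_vecMulVec_self (p : QuadFun n) (y : Fin n → ℝ) :
    (p.A * Matrix.vecMulVec y y).trace = y ⬝ᵥ (p.A *ᵥ y) := by
  rw [Matrix.mul_vecMulVec, Matrix.trace_vecMulVec, dotProduct_comm]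

theorem kerPerp_ne_iff (q : Fin 2 → QuadFun n) (γ : Fin 2 → ℝ) :
    kerPerp q γ ≠ {0} ↔ ∃ y ≠ 0, aggA q γ *ᵥ y = 0 ∧ aggb q γ ⬝ᵥ y = 0 := by
  constructor
  · intro h
    by_contra! hy
    refine h (Set.eq_singleton_iff_unique_mem.2 ⟨by simp [kerPerp], fun y hk ↦ ?_⟩)
    by_contra hne
    exact hy y hne hk.1 hk.2
  · rintro ⟨y, hne, hy⟩ h
    have hm : y ∈ kerPerp q γ := hy
    rw [h] at hm
    exact hne hm

/-! ### Generators of `Γ₁` and the projected relaxation -/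

/-- The standing assumptions: some aggregation in `ℝ²₊` is positive definite, and `g 0, g 1`
generate the cone `Γ₁`. -/
structure IsGenerated (q : Fin 2 → QuadFun n) (g : Fin 2 → Fin 2 → ℝ) : Prop where
  nonneg : ∀ i k, 0 ≤ g i k
  posSemidef : ∀ i, (aggA q (g i)).PosSemidef
  exists_combo : ∀ γ ∈ Gamma1 q, ∀ i j, i ≠ j →
    ∃ a b : ℝ, 0 ≤ a ∧ 0 ≤ b ∧ ∀ k, γ k = a * g i k + b * g j k
  exists_posDef : ∃ γ : Fin 2 → ℝ, (∀ k, 0 ≤ γ k) ∧ (aggA q γ).PosDef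

theorem isGenerated_of_hull {q : Fin 2 → QuadFun n}
    (hdef : ∃ γ : Fin 2 → ℝ, (∀ k, 0 ≤ γ k) ∧ (aggA q γ).PosDef)
    {g : Fin 2 → Fin 2 → ℝ} (hg : ∀ i k, 0 ≤ g i k)
    (hgen : Gamma1 q = (PointedCone.hull ℝ (Set.range g) : Set (Fin 2 → ℝ))) :
    IsGenerated q g where
  nonneg := hg
  posSemidef i := by
    have h : g i ∈ Gamma1 q := by
      rw [hgen]
      exact PointedCone.subset_hull ⟨i, rfl⟩
    exact h.2
  exists_combo γ hγ i j hij := by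
    rw [hgen] at hγ
    obtain ⟨c, hc⟩ := Submodule.mem_span_range_iff_exists_fun _ |>.1 hγ
    refine ⟨c i, c j, (c i).2, (c j).2, fun k ↦ ?_⟩
    rw [← hc, Fin.sum_univ_two]
    fin_cases i <;> fin_cases j <;> first | exact absurd rfl hij | skip
    · rfl
    · exact add_comm _ _
  exists_posDef := hdef

namespace IsGenerated

variable {q : Fin 2 → QuadFun n} {g : Fin 2 → Fin 2 → ℝ}

/-- Dependent generators would make all members of `Γ₁` proportional, yet a positive definite
aggregation can be moved a little along either axis inside `Γ₁`. -/
theorem det_ne_zero (h : IsGenerated q g) {i j : Fin 2} (hij : i ≠ j) :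
    g i 0 * g j 1 - g i 1 * g j 0 ≠ 0 := by
  intro hdet
  obtain ⟨γ, hγ, hpd⟩ := h.exists_posDef
  have hdep : ∀ α ∈ Gamma1 q, ∀ β ∈ Gamma1 q, α 0 * β 1 - α 1 * β 0 = 0 := by
    intro α hα β hβ
    obtain ⟨a, b, -, -, hab⟩ := h.exists_combo α hα i j hij
    obtain ⟨c, d, -, -, hcd⟩ := h.exists_combo β hβ i j hij
    rw [hab 0, hab 1, hcd 0, hcd 1]
    linear_combination (a * d - b * c) * hdet
  have hpert : ∀ k, ∃ ε : ℝ, 0 < ε ∧ γ + ε • Pi.single k 1 ∈ Gamma1 q := by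
    intro k
    obtain ⟨ε, hε, hε'⟩ := hpd.exists_posSemidef_add_smul (agg q (Pi.single k 1)).symm
    refine ⟨ε, hε, fun l ↦ ?_, ?_⟩
    · have h1 : (0 : ℝ) ≤ (Pi.single k 1 : Fin 2 → ℝ) l := by
        rw [Pi.single_apply]
        split_ifs <;> norm_num
      exact add_nonneg (hγ l) (mul_nonneg hε.le h1)
    · rw [aggA_add, aggA_smul]
      exact hε' ε hε.le le_rfl
  obtain ⟨ε, hε, hε'⟩ := hpert 0
  obtain ⟨δ, hδ, hδ'⟩ := hpert 1
  have hγm : γ ∈ Gamma1 q := ⟨hγ, hpd.posSemidef⟩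
  have h0 := hdep _ hε' _ hγm
  have h1 := hdep _ hγm _ hδ'
  have h2 := hdep _ hε' _ hδ'
  simp at h0 h1 h2
  have h3 : γ 1 = 0 := by
    have : ε * γ 1 = 0 := by linarith
    exact (mul_eq_zero.1 this).resolve_left hε.ne'
  have h4 : γ 0 = 0 := by
    have : δ * γ 0 = 0 := by linarith
    exact (mul_eq_zero.1 this).resolve_left hδ.ne'
  rw [h3, h4] at h2
  have := mul_pos hε hδ
  linarith

/-- A generator with positive coordinates has a singular aggregated matrix. -/
theorem exists_ker (h : IsGenerated q g) {i j : Fin 2} (hij : i ≠ j) (hi : ∀ k, 0 < g i k) :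
    ∃ y ≠ 0, aggA q (g i) *ᵥ y = 0 := by
  by_contra! hker
  have hpd : (aggA q (g i)).PosDef := by
    refine Matrix.PosDef.of_dotProduct_mulVec_pos (h.posSemidef i).isHermitian fun x hx ↦ ?_
    exact ((h.posSemidef i).dotProduct_mulVec_nonneg x).lt_of_ne' fun h0 ↦
      hker x hx (((h.posSemidef i).dotProduct_mulVec_zero_iff x).1 h0)
  -- Were `A[g i]` definite, `g i - ε g j` would stay in `Γ₁`; independence then forces its
  -- nonnegative `g j`-coefficient to be `-ε`.
  obtain ⟨δ, hδ, hδ'⟩ := hpd.exists_posSemidef_add_smul (agg q (-g j)).symm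
  have hsmall : ∃ ε : ℝ, 0 < ε ∧ ε ≤ δ ∧ ∀ k, ε * g j k ≤ g i k := by
    have hk : ∀ k, ∃ ε : ℝ, 0 < ε ∧ ε * g j k ≤ g i k := fun k ↦
      -- The `+ 1` keeps the denominator positive when `g j k = 0`.
      ⟨g i k / (g j k + 1), div_pos (hi k) (by linarith [h.nonneg j k]), by
        have := h.nonneg j k
        rw [div_mul_eq_mul_div, div_le_iff₀ (by linarith)]
        nlinarith [hi k]⟩
    choose e he he' using hk
    refine ⟨min δ (min (e 0) (e 1)), lt_min hδ (lt_min (he 0) (he 1)), min_le_left _ _,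
      fun k ↦ (mul_le_mul_of_nonneg_right ?_ (h.nonneg j k)).trans (he' k)⟩
    refine (min_le_right _ _).trans ?_
    fin_cases k
    exacts [min_le_left _ _, min_le_right _ _]
  obtain ⟨ε, hε, hεδ, hεg⟩ := hsmall
  have hmem : g i + ε • (-g j) ∈ Gamma1 q := by
    refine ⟨fun k ↦ ?_, ?_⟩
    · have := hεg k
      simp only [Pi.add_apply, Pi.smul_apply, Pi.neg_apply, smul_eq_mul]
      linarith
    · rw [aggA_add, aggA_smul]
      exact hδ' ε hε.le hεδ
  obtain ⟨a, b, -, hb, hab⟩ := h.exists_combo _ hmem i j hij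
  have h0 := hab 0
  have h1 := hab 1
  simp only [Pi.add_apply, Pi.smul_apply, Pi.neg_apply, smul_eq_mul] at h0 h1
  have : (b + ε) * (g i 0 * g j 1 - g i 1 * g j 0) = 0 := by
    linear_combination g i 1 * h0 - g i 0 * h1
  rcases mul_eq_zero.1 this with h2 | h2
  · linarith
  · exact h.det_ne_zero hij h2

/-- In a positive definite combination `a g i + b g j`, only the `b` term survives on the kernel of
`A[g i]`. -/
theorem quad_pos (h : IsGenerated q g) {i j : Fin 2} (hij : i ≠ j) {y : Fin n → ℝ} (hy : y ≠ 0)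
    (hk : aggA q (g i) *ᵥ y = 0) : 0 < y ⬝ᵥ (aggA q (g j) *ᵥ y) := by
  obtain ⟨γ, hγ, hpd⟩ := h.exists_posDef
  obtain ⟨a, b, -, hb, hab⟩ := h.exists_combo γ ⟨hγ, hpd.posSemidef⟩ i j hij
  have h1 := hpd.dotProduct_mulVec_pos hy
  have h2 : y ⬝ᵥ (aggA q (g i) *ᵥ y) = 0 := by rw [hk, dotProduct_zero]
  rw [star_trivial, dotProduct_aggA_mulVec, hab 0, hab 1] at h1
  rw [dotProduct_aggA_mulVec] at h2 ⊢
  refine pos_of_mul_pos_right (a := b) ?_ hb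
  linear_combination h1 + a * h2

/-- A direction in which the aggregation by `g i` is stationary and that by `g j` increases. -/
theorem exists_recession (h : IsGenerated q g) {i j : Fin 2} (hij : i ≠ j) :
    ∃ (y : Fin n → ℝ) (s : Fin 2 → ℝ), (∀ k, 0 ≤ s k) ∧
      g i 0 * (y ⬝ᵥ ((q 0).A *ᵥ y) + s 0) + g i 1 * (y ⬝ᵥ ((q 1).A *ᵥ y) + s 1) = 0 ∧
      0 < g j 0 * (y ⬝ᵥ ((q 0).A *ᵥ y) + s 0) + g j 1 * (y ⬝ᵥ ((q 1).A *ᵥ y) + s 1) := by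
  by_cases hi : ∀ k, 0 < g i k
  · obtain ⟨y, hy, hk⟩ := h.exists_ker hij hi
    refine ⟨y, 0, fun _ ↦ le_rfl, ?_, ?_⟩
    · simp only [Pi.zero_apply, add_zero]
      rw [← dotProduct_aggA_mulVec, hk, dotProduct_zero]
    · simp only [Pi.zero_apply, add_zero]
      rw [← dotProduct_aggA_mulVec]
      exact h.quad_pos hij hy hk
  -- For a generator on an axis no direction is needed: slack in the constraint it ignores costs it
  -- nothing, and the other generator weighs it positively.
  · push Not at hi
    obtain ⟨k, hk⟩ := hi
    have hk0 : g i k = 0 := le_antisymm hk (h.nonneg i k)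
    have hjk : g j k ≠ 0 := by
      intro hjk
      have := h.det_ne_zero hij
      fin_cases k <;> simp_all
    have hpos : 0 < g j k := (h.nonneg j k).lt_of_ne' hjk
    refine ⟨0, Pi.single k 1, fun l ↦ ?_, ?_, ?_⟩
    · rw [Pi.single_apply]
      split_ifs <;> norm_num
    · fin_cases k <;> simpa using hk0
    · fin_cases k <;> simpa using hpos

/-- The projected SDP relaxation is cut out by the two aggregated convex constraints. -/
theorem mem_sdpSet_iff (h : IsGenerated q g) {x : Fin n → ℝ} :
    x ∈ sdpSet q ↔ ∀ i, aggEval q (g i) x ≤ 0 := by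
  constructor
  · rintro ⟨X, hX, hl⟩ i
    have hl' : ∀ k, ((q k).A * (X - Matrix.vecMulVec x x)).trace + (q k).eval x ≤ 0 := by
      intro k
      have := hl k
      rwa [← sub_add_cancel X (Matrix.vecMulVec x x), lift_add_vecMulVec] at this
    have htr := (h.posSemidef i).trace_mul_nonneg hX
    simp only [aggA, Fin.sum_univ_two, Matrix.add_mul, Matrix.smul_mul, Matrix.trace_add,
      Matrix.trace_smul, smul_eq_mul] at htr
    rw [aggEval_eq]
    have h0 := mul_nonpos_of_nonneg_of_nonpos (h.nonneg i 0) (hl' 0)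
    have h1 := mul_nonpos_of_nonneg_of_nonpos (h.nonneg i 1) (hl' 1)
    linarith
  · intro hx
    obtain ⟨y, s, hs, hy0, hy1⟩ := h.exists_recession (i := 0) (j := 1) (by decide)
    obtain ⟨z, r, hr, hz1, hz0⟩ := h.exists_recession (i := 1) (j := 0) (by decide)
    have hp0 := hx 0
    have hp1 := hx 1
    rw [aggEval_eq] at hp0 hp1
    set Y : Fin 2 → ℝ := fun k ↦ y ⬝ᵥ ((q k).A *ᵥ y) with hY
    set Z : Fin 2 → ℝ := fun k ↦ z ⬝ᵥ ((q k).A *ᵥ z) with hZ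
    -- The multiples `t` and `u` bring both aggregated values to zero. Independence of the
    -- generators then makes each constraint plus its slack vanish.
    obtain ⟨t, ht, ht1⟩ : ∃ t : ℝ, 0 ≤ t ∧ t * (g 1 0 * (Y 0 + s 0) + g 1 1 * (Y 1 + s 1)) =
        -(g 1 0 * (q 0).eval x + g 1 1 * (q 1).eval x) :=
      ⟨_, div_nonneg (neg_nonneg.2 hp1) hy1.le, div_mul_cancel₀ _ hy1.ne'⟩
    obtain ⟨u, hu, hu0⟩ : ∃ u : ℝ, 0 ≤ u ∧ u * (g 0 0 * (Z 0 + r 0) + g 0 1 * (Z 1 + r 1)) =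
        -(g 0 0 * (q 0).eval x + g 0 1 * (q 1).eval x) :=
      ⟨_, div_nonneg (neg_nonneg.2 hp0) hz0.le, div_mul_cancel₀ _ hz0.ne'⟩
    have hdet := h.det_ne_zero (i := 0) (j := 1) (by decide)
    have hw : ∀ k, (q k).eval x + t * (Y k + s k) + u * (Z k + r k) = 0 := by
      refine Fin.forall_fin_two.2 ⟨?_, ?_⟩ <;> refine (mul_eq_zero.1 ?_).resolve_left hdet
      · linear_combination g 1 1 * (t * hy0 + hu0) - g 0 1 * (u * hz1 + ht1)
      · linear_combination g 0 0 * (u * hz1 + ht1) - g 1 0 * (t * hy0 + hu0)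
    refine ⟨(t • Matrix.vecMulVec y y + u • Matrix.vecMulVec z z) + Matrix.vecMulVec x x, ?_,
      fun k ↦ ?_⟩
    · rw [add_sub_cancel_right]
      have hyy := (Matrix.posSemidef_vecMulVec_self_star y).smul ht
      have hzz := (Matrix.posSemidef_vecMulVec_self_star z).smul hu
      rw [star_trivial] at hyy hzz
      exact hyy.add hzz
    · rw [lift_add_vecMulVec, Matrix.mul_add, Matrix.mul_smul, Matrix.mul_smul, Matrix.trace_add,
        Matrix.trace_smul, Matrix.trace_smul, trace_mul_vecMulVec_self, trace_mul_vecMulVec_self,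
        smul_eq_mul, smul_eq_mul]
      have h1 := mul_nonneg ht (hs k)
      have h2 := mul_nonneg hu (hr k)
      have h3 := hw k
      simp only [hY, hZ] at h3
      linarith

theorem feasibleSet_subset_sdpSet (h : IsGenerated q g) : feasibleSet q ⊆ sdpSet q := by
  intro x hx
  refine h.mem_sdpSet_iff.2 fun i ↦ ?_
  rw [aggEval_eq]
  exact add_nonpos (mul_nonpos_of_nonneg_of_nonpos (h.nonneg i 0) (hx 0))
    (mul_nonpos_of_nonneg_of_nonpos (h.nonneg i 1) (hx 1))

theorem convex_sdpSet (h : IsGenerated q g) : Convex ℝ (sdpSet q) := by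
  have heq : sdpSet q = ⋂ i, {x | x ∈ Set.univ ∧ (agg q (g i)).eval x ≤ 0} := by
    ext x
    simp [h.mem_sdpSet_iff, eval_agg]
  rw [heq]
  exact convex_iInter fun i ↦ ((agg q (g i)).convexOn_eval (h.posSemidef i)).convex_le 0

end IsGenerated

end QuadFun

/-! ### Sufficiency: kernel rays reach the feasible set -/

/-- A concave quadratic which is positive at `0` has a positive root. -/
theorem exists_pos_root_of_concave {a c : ℝ} (b : ℝ) (ha : a < 0) (hc : 0 < c) :
    ∃ t, 0 < t ∧ c + t * b + t ^ 2 * a = 0 := by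
  have hac : 0 < -(4 * a * c) := by nlinarith
  have hs : 0 ≤ b ^ 2 - 4 * a * c := by nlinarith [sq_nonneg b]
  have hsq := Real.sq_sqrt hs
  have hlt : -b < Real.sqrt (b ^ 2 - 4 * a * c) := by
    refine Real.lt_sqrt_of_sq_lt ?_
    nlinarith
  set r := Real.sqrt (b ^ 2 - 4 * a * c)
  refine ⟨(b + r) / (-2 * a), div_pos (by linarith) (by linarith), ?_⟩
  have ht : (b + r) / (-2 * a) * (-2 * a) = b + r := div_mul_cancel₀ _ (by linarith)
  set t := (b + r) / (-2 * a)
  refine (mul_eq_zero.1 (?_ : 4 * a * (c + t * b + t ^ 2 * a) = 0)).resolve_left (by linarith)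
  linear_combination hsq + (-2 * a * t + r - b) * ht

namespace QuadFun

variable {n : ℕ}

theorem aggEval_eq_of_ne (q : Fin 2 → QuadFun n) (γ : Fin 2 → ℝ) (x : Fin n → ℝ) {k l : Fin 2}
    (hkl : k ≠ l) : aggEval q γ x = γ k * (q k).eval x + γ l * (q l).eval x := by
  rw [aggEval_eq]
  fin_cases k <;> fin_cases l <;> first | exact absurd rfl hkl | skip
  · rfl
  · exact add_comm _ _

theorem dotProduct_aggA_mulVec_of_ne (q : Fin 2 → QuadFun n) (γ : Fin 2 → ℝ) (y : Fin n → ℝ)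
    {k l : Fin 2} (hkl : k ≠ l) :
    y ⬝ᵥ (aggA q γ *ᵥ y) = γ k * (y ⬝ᵥ ((q k).A *ᵥ y)) + γ l * (y ⬝ᵥ ((q l).A *ᵥ y)) := by
  rw [dotProduct_aggA_mulVec]
  fin_cases k <;> fin_cases l <;> first | exact absurd rfl hkl | skip
  · rfl
  · exact add_comm _ _

theorem aggEval_add_smul_of_mulVec_eq_zero (q : Fin 2 → QuadFun n) (γ : Fin 2 → ℝ)
    (x : Fin n → ℝ) {y : Fin n → ℝ} (hy : aggA q γ *ᵥ y = 0) (t : ℝ) :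
    aggEval q γ (x + t • y) = aggEval q γ x + t * (2 * (aggb q γ ⬝ᵥ y)) := by
  rw [← eval_agg, ← eval_agg]
  exact (agg q γ).eval_add_smul_of_mulVec_eq_zero x hy t

theorem aggEval_add_smul (q : Fin 2 → QuadFun n) (γ : Fin 2 → ℝ) (x y : Fin n → ℝ) :
    ∃ b : ℝ, ∀ t : ℝ, aggEval q γ (x + t • y) =
      aggEval q γ x + t * b + t ^ 2 * (y ⬝ᵥ (aggA q γ *ᵥ y)) := by
  simp only [← eval_agg]
  exact ⟨_, (agg q γ).eval_add_smul x y⟩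

namespace IsGenerated

variable {q : Fin 2 → QuadFun n} {g : Fin 2 → Fin 2 → ℝ}

theorem det_ne_zero_of_ne (h : IsGenerated q g) {i j k l : Fin 2} (hij : i ≠ j) (hkl : k ≠ l) :
    g i k * g j l - g i l * g j k ≠ 0 := by
  have := h.det_ne_zero hij
  fin_cases k <;> fin_cases l <;> first | exact absurd rfl hkl | skip
  · exact this
  · intro h0
    refine this (neg_eq_zero.1 ?_)
    rw [neg_sub]
    exact h0

/-- Selects as `i` the generator weighting constraint `k` relatively more; this is the one that
matters where `k` is violated. -/
theorem exists_orientation (h : IsGenerated q g) {k l : Fin 2} (hkl : k ≠ l) :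
    ∃ i j : Fin 2, i ≠ j ∧ 0 < g i k * g j l - g i l * g j k := by
  rcases (h.det_ne_zero_of_ne (i := 0) (j := 1) (by decide) hkl).lt_or_gt with h0 | h0
  · exact ⟨1, 0, by decide, by linarith⟩
  · exact ⟨0, 1, by decide, h0⟩

/-- Moving along a kernel direction of `A[g i]` from a point violating only the constraint `k`
reaches the feasible set. -/
theorem exists_mem_feasibleSet_ray {i j k l : Fin 2} (hkl : k ≠ l) (hil : 0 < g i l)
    (hdet : 0 < g i k * g j l - g i l * g j k) {x y : Fin n → ℝ}
    (hx : aggEval q (g i) x ≤ 0) (hxk : 0 < (q k).eval x) (hy : aggA q (g i) *ᵥ y = 0)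
    (hyk : y ⬝ᵥ ((q k).A *ᵥ y) < 0)
    (halt : aggb q (g i) ⬝ᵥ y = 0 ∨ ∀ z, aggEval q (g i) z = 0 → 0 ≤ aggEval q (g j) z) :
    ∃ t : ℝ, 0 < t ∧ x + t • y ∈ feasibleSet q := by
  set b := 2 * (x ⬝ᵥ ((q k).A *ᵥ y) + (q k).b ⬝ᵥ y) with hb
  obtain ⟨t, ht, htk⟩ := exists_pos_root_of_concave b hyk hxk
  have hk : (q k).eval (x + t • y) = 0 := by rw [eval_add_smul, ← hb, htk]
  have hi : aggEval q (g i) (x + t • y) ≤ 0 := by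
    by_contra! hpos
    rw [aggEval_add_smul_of_mulVec_eq_zero q _ x hy] at hpos
    rcases halt with h0 | hz
    · rw [h0] at hpos
      linarith
    set β := t * (2 * (aggb q (g i) ⬝ᵥ y)) with hβ
    have hβ0 : 0 < β := by linarith
    -- At parameter `θ * t` the affine restriction of aggregation `i` crosses zero. By concavity `q
    -- k` is still positive there, so the determinant sign makes aggregation `j` negative, contrary
    -- to `halt`.
    set θ := -aggEval q (g i) x / β with hθ
    have hθ0 : 0 ≤ θ := div_nonneg (by linarith) hβ0.le
    have hθ1 : θ < 1 := by
      rw [hθ, div_lt_one hβ0]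
      linarith
    have hθβ : θ * β = -aggEval q (g i) x := div_mul_cancel₀ _ hβ0.ne'
    have h1 : aggEval q (g i) (x + (θ * t) • y) = 0 := by
      rw [aggEval_add_smul_of_mulVec_eq_zero q _ x hy]
      linear_combination hθβ + θ * hβ
    have h2 : 0 < (q k).eval (x + (θ * t) • y) := by
      have h3 : (q k).eval (x + (θ * t) • y) = (1 - θ) * (q k).eval x +
          θ * (1 - θ) * t ^ 2 * -(y ⬝ᵥ ((q k).A *ᵥ y)) := by
        rw [eval_add_smul, ← hb]
        linear_combination θ * htk
      rw [h3]
      exact add_pos_of_pos_of_nonneg (mul_pos (by linarith) hxk)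
        (mul_nonneg (mul_nonneg (mul_nonneg hθ0 (by linarith)) (sq_nonneg t)) (by linarith))
    have h4 := hz _ h1
    rw [aggEval_eq_of_ne q _ _ hkl] at h1 h4
    have h5 := mul_nonneg hil.le h4
    have h6 := mul_pos hdet h2
    have h7 : g i l * (g j k * (q k).eval (x + (θ * t) • y) +
        g j l * (q l).eval (x + (θ * t) • y)) +
        (g i k * g j l - g i l * g j k) * (q k).eval (x + (θ * t) • y) = 0 := by
      linear_combination g j l * h1
    linarith
  refine ⟨t, ht, fun m ↦ ?_⟩
  rw [aggEval_eq_of_ne q _ _ hkl, hk, mul_zero, zero_add] at hi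
  have hl : (q l).eval (x + t • y) ≤ 0 := by
    by_contra! hl
    linarith [mul_pos hil hl]
  have hm : m = k ∨ m = l := by omega
  rcases hm with rfl | rfl
  exacts [hk.le, hl]

/-- The sufficiency of the kernel condition for convex hull exactness. -/
theorem sdpSet_subset_convexHull (h : IsGenerated q g)
    (hker : ∀ i j : Fin 2, i ≠ j → (∀ k, 0 < g i k) →
      (∃ x, aggEval q (g i) x = 0 ∧ aggEval q (g j) x < 0) → kerPerp q (g i) ≠ {0}) :
    sdpSet q ⊆ convexHull ℝ (feasibleSet q) := by
  intro x hx
  rw [h.mem_sdpSet_iff] at hx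
  by_cases hf : x ∈ feasibleSet q
  · exact subset_convexHull ℝ _ hf
  obtain ⟨k, hxk⟩ : ∃ k, 0 < (q k).eval x := by
    by_contra! hc
    exact hf hc
  obtain ⟨l, hkl⟩ : ∃ l, k ≠ l := (exists_ne k).imp fun _ hl ↦ hl.symm
  obtain ⟨i, j, hij, hdet⟩ := h.exists_orientation hkl
  have hik : 0 < g i k := by
    refine (h.nonneg i k).lt_of_ne' fun h0 ↦ ?_
    have := mul_nonneg (h.nonneg i l) (h.nonneg j k)
    rw [h0] at hdet
    linarith
  have hil : 0 < g i l := by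
    refine (h.nonneg i l).lt_of_ne' fun h0 ↦ ?_
    have h1 := hx i
    rw [aggEval_eq_of_ne q _ _ hkl, h0] at h1
    linarith [mul_pos hik hxk]
  have hpos : ∀ m, 0 < g i m := by
    intro m
    have hm : m = k ∨ m = l := by omega
    rcases hm with rfl | rfl
    exacts [hik, hil]
  obtain ⟨y, hy0, hy, halt⟩ : ∃ y ≠ 0, aggA q (g i) *ᵥ y = 0 ∧
      (aggb q (g i) ⬝ᵥ y = 0 ∨ ∀ z, aggEval q (g i) z = 0 → 0 ≤ aggEval q (g j) z) := by
    by_cases hz : ∃ z, aggEval q (g i) z = 0 ∧ aggEval q (g j) z < 0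
    · obtain ⟨y, hy0, hy, hb⟩ := (kerPerp_ne_iff q _).1 (hker i j hij hpos hz)
      exact ⟨y, hy0, hy, Or.inl hb⟩
    · push Not at hz
      obtain ⟨y, hy0, hy⟩ := h.exists_ker hij hpos
      exact ⟨y, hy0, hy, Or.inr hz⟩
  -- Along `y` aggregation `i` has zero curvature and `j` positive curvature; eliminating the
  -- curvature of `q l` leaves that of `q k` negative.
  have hyk : y ⬝ᵥ ((q k).A *ᵥ y) < 0 := by
    have h1 := h.quad_pos hij hy0 hy
    have h2 : y ⬝ᵥ (aggA q (g i) *ᵥ y) = 0 := by rw [hy, dotProduct_zero]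
    rw [dotProduct_aggA_mulVec_of_ne q _ _ hkl] at h1 h2
    have h3 := mul_pos hil h1
    refine neg_of_mul_neg_left (b := g i k * g j l - g i l * g j k) ?_ hdet.le
    linear_combination h3 + g j l * h2
  obtain ⟨t, ht, htf⟩ := exists_mem_feasibleSet_ray hkl hil hdet (hx i) hxk hy hyk halt
  obtain ⟨s, hs, hsf⟩ := exists_mem_feasibleSet_ray (y := -y) hkl hil hdet (hx i) hxk
    (by rw [Matrix.mulVec_neg, hy, neg_zero])
    (by simpa [Matrix.mulVec_neg] using hyk)
    (halt.imp_left fun h0 ↦ by rw [dotProduct_neg, h0, neg_zero])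
  have hts : 0 < t + s := add_pos ht hs
  have hcomb := (convex_convexHull ℝ (feasibleSet q)) (subset_convexHull ℝ _ htf)
    (subset_convexHull ℝ _ hsf) (div_nonneg hs.le hts.le) (div_nonneg ht.le hts.le)
    (by rw [← add_div, add_comm s, div_self hts.ne'])
  convert hcomb using 1
  ext m
  simp only [Pi.add_apply, Pi.smul_apply, Pi.neg_apply, smul_eq_mul]
  field_simp
  ring

/-! ### Necessity: extreme points of the relaxation -/

/-- The necessity of the kernel condition for convex hull exactness. -/
theorem kerPerp_ne_of_convexHull_eq (h : IsGenerated q g)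
    (heq : convexHull ℝ (feasibleSet q) = sdpSet q) {i j : Fin 2} (hij : i ≠ j)
    (hi : ∀ k, 0 < g i k) (hx : ∃ x, aggEval q (g i) x = 0 ∧ aggEval q (g j) x < 0) :
    kerPerp q (g i) ≠ {0} := by
  intro hker
  obtain ⟨x, hxi, hxj⟩ := hx
  -- On a segment through `x`, the convex aggregation `i` is zero at `x` and nonpositive at the
  -- ends, so it vanishes at both and has no curvature. The segment direction then lies in
  -- `kerPerp`.
  have hext : x ∈ (sdpSet q).extremePoints ℝ := by
    refine mem_extremePoints_iff_left.2 ⟨h.mem_sdpSet_iff.2 fun m ↦ ?_, ?_⟩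
    · have hm : m = i ∨ m = j := by omega
      rcases hm with rfl | rfl
      exacts [hxi.le, hxj.le]
    · rintro u hu v hv ⟨a, b, ha, hb, hab, rfl⟩
      have hui := h.mem_sdpSet_iff.1 hu i
      have hvi := h.mem_sdpSet_iff.1 hv i
      rw [← eval_agg] at hui hvi
      rw [← eval_agg, eval_convexCombo _ _ _ hab] at hxi
      have hquad := (h.posSemidef i).dotProduct_mulVec_nonneg (u - v)
      rw [star_trivial] at hquad
      have h1 := mul_nonpos_of_nonneg_of_nonpos ha.le hui
      have h2 := mul_nonpos_of_nonneg_of_nonpos hb.le hvi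
      have h3 := mul_nonneg (mul_pos ha hb).le hquad
      change _ - a * b * ((u - v) ⬝ᵥ (aggA q (g i) *ᵥ (u - v))) = 0 at hxi
      have h4 : a * b * ((u - v) ⬝ᵥ (aggA q (g i) *ᵥ (u - v))) = 0 := by linarith
      have h5 : (agg q (g i)).eval u = 0 :=
        (mul_eq_zero.1 (by linarith : a * (agg q (g i)).eval u = 0)).resolve_left ha.ne'
      have h6 : (agg q (g i)).eval v = 0 :=
        (mul_eq_zero.1 (by linarith : b * (agg q (g i)).eval v = 0)).resolve_left hb.ne'
      have h7 : aggA q (g i) *ᵥ (u - v) = 0 := by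
        refine ((h.posSemidef i).dotProduct_mulVec_zero_iff _).1 ?_
        exact (mul_eq_zero.1 h4).resolve_left (mul_pos ha hb).ne'
      have h8 : aggb q (g i) ⬝ᵥ (u - v) = 0 := by
        have h9 := aggEval_add_smul_of_mulVec_eq_zero q (g i) v h7 1
        rw [one_smul, add_sub_cancel, ← eval_agg, ← eval_agg, h5, h6] at h9
        linarith
      have huv : u - v ∈ kerPerp q (g i) := ⟨h7, h8⟩
      rw [hker, Set.mem_singleton_iff, sub_eq_zero] at huv
      rw [← huv, ← add_smul, hab, one_smul]
  rw [← heq] at hext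
  have hxf : x ∈ feasibleSet q := extremePoints_convexHull_subset hext
  have h0 := mul_nonpos_of_nonneg_of_nonpos (hi 0).le (hxf 0)
  have h1 := mul_nonpos_of_nonneg_of_nonpos (hi 1).le (hxf 1)
  rw [aggEval_eq] at hxi hxj
  have h2 : (q 0).eval x = 0 :=
    (mul_eq_zero.1 (by linarith : g i 0 * (q 0).eval x = 0)).resolve_left (hi 0).ne'
  have h3 : (q 1).eval x = 0 :=
    (mul_eq_zero.1 (by linarith : g i 1 * (q 1).eval x = 0)).resolve_left (hi 1).ne'
  rw [h2, h3] at hxj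
  linarith

theorem convexHull_eq_iff (h : IsGenerated q g) :
    convexHull ℝ (feasibleSet q) = sdpSet q ↔
      ∀ i j : Fin 2, i ≠ j → (∀ k, 0 < g i k) →
        (∃ x, aggEval q (g i) x = 0 ∧ aggEval q (g j) x < 0) → kerPerp q (g i) ≠ {0} :=
  ⟨fun heq _ _ hij hi hx ↦ h.kerPerp_ne_of_convexHull_eq heq hij hi hx, fun hker ↦
    (convexHull_min h.feasibleSet_subset_sdpSet h.convex_sdpSet).antisymm
      (h.sdpSet_subset_convexHull hker)⟩

/-! ### The nonconvex case with a Slater point -/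

/-- A generator on an axis would make a positive multiple of a single `A` semidefinite, hence that
constraint convex. -/
theorem generator_pos_of_nonconvex (h : IsGenerated q g)
    (hnc : ∀ k, ¬ ConvexOn ℝ Set.univ (q k).eval) (i k : Fin 2) : 0 < g i k := by
  refine (h.nonneg i k).lt_of_ne' fun hk ↦ ?_
  obtain ⟨l, hkl⟩ : ∃ l, k ≠ l := (exists_ne k).imp fun _ hl ↦ hl.symm
  obtain ⟨j, hij⟩ : ∃ j, i ≠ j := (exists_ne i).imp fun _ hj ↦ hj.symm
  have hl : 0 < g i l := by
    refine (h.nonneg i l).lt_of_ne' fun hl ↦ h.det_ne_zero_of_ne hij hkl ?_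
    rw [hk, hl]
    ring
  refine hnc l ((q l).convexOn_eval (Matrix.PosSemidef.of_dotProduct_mulVec_nonneg ?_ fun x ↦ ?_))
  · rw [Matrix.IsHermitian, Matrix.conjTranspose_eq_transpose_of_trivial]
    exact (q l).symm
  · have := (h.posSemidef i).dotProduct_mulVec_nonneg x
    rw [star_trivial, dotProduct_aggA_mulVec_of_ne q _ _ hkl, hk, zero_mul, zero_add] at this
    exact nonneg_of_mul_nonneg_right this hl

/-- Under a Slater condition, each aggregated constraint is active somewhere strictly inside the
other one. -/
theorem exists_aggEval_eq_zero_lt (h : IsGenerated q g) (hpos : ∀ i k, 0 < g i k)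
    (hslater : ∃ x, ∀ k, (q k).eval x < 0) {i j : Fin 2} (hij : i ≠ j) :
    ∃ x, aggEval q (g i) x = 0 ∧ aggEval q (g j) x < 0 := by
  obtain ⟨x, hx⟩ := hslater
  have hneg : ∀ m, aggEval q (g m) x < 0 := fun m ↦ by
    rw [aggEval_eq]
    exact add_neg (mul_neg_of_pos_of_neg (hpos m 0) (hx 0))
      (mul_neg_of_pos_of_neg (hpos m 1) (hx 1))
  -- The sign of the kernel direction is chosen so that aggregation `j` does not increase, while the
  -- strictly convex aggregation `i` climbs from negative to zero.
  obtain ⟨z, hz0, hz, hbz⟩ : ∃ z ≠ 0, aggA q (g j) *ᵥ z = 0 ∧ aggb q (g j) ⬝ᵥ z ≤ 0 := by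
    obtain ⟨z, hz0, hz⟩ := h.exists_ker hij.symm (hpos j)
    rcases le_total (aggb q (g j) ⬝ᵥ z) 0 with hb | hb
    · exact ⟨z, hz0, hz, hb⟩
    · exact ⟨-z, neg_ne_zero.2 hz0, by rw [Matrix.mulVec_neg, hz, neg_zero],
        by rw [dotProduct_neg]; linarith⟩
  have hquad := h.quad_pos hij.symm hz0 hz
  obtain ⟨b, hb⟩ := aggEval_add_smul q (g i) x z
  obtain ⟨t, ht, htr⟩ := exists_pos_root_of_concave (-b) (neg_neg_of_pos hquad)
    (neg_pos.2 (hneg i))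
  refine ⟨x + t • z, ?_, ?_⟩
  · rw [hb]
    linarith
  · rw [aggEval_add_smul_of_mulVec_eq_zero q _ x hz]
    linarith [hneg j, mul_nonpos_of_nonneg_of_nonpos ht.le hbz]

end IsGenerated

end QuadFun

theorem mainTheorem5 {n : ℕ} (q : Fin 2 → QuadFun n)
    (hdef : ∃ γ : Fin 2 → ℝ, (∀ k, 0 ≤ γ k) ∧ (QuadFun.aggA q γ).PosDef)
    (g : Fin 2 → Fin 2 → ℝ) (hg : ∀ i k, 0 ≤ g i k)
    (hgen : QuadFun.Gamma1 q = (PointedCone.hull ℝ (Set.range g) : Set (Fin 2 → ℝ))) :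
    (convexHull ℝ (QuadFun.feasibleSet q) = QuadFun.sdpSet q ↔
      ∀ i j : Fin 2, i ≠ j → (∀ k, 0 < g i k) →
        (∃ x, QuadFun.aggEval q (g i) x = 0 ∧ QuadFun.aggEval q (g j) x < 0) →
        QuadFun.kerPerp q (g i) ≠ {0}) ∧
    ((∀ i, ¬ ConvexOn ℝ Set.univ (q i).eval) → (∃ x, ∀ i, (q i).eval x < 0) →
      (convexHull ℝ (QuadFun.feasibleSet q) = QuadFun.sdpSet q ↔
        ∀ i, QuadFun.kerPerp q (g i) ≠ {0})) := by
  have h := QuadFun.isGenerated_of_hull hdef hg hgen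
  refine ⟨h.convexHull_eq_iff, fun hnc hslater ↦ h.convexHull_eq_iff.trans ⟨fun hker i ↦ ?_,
    fun hker i _ _ _ _ ↦ hker i⟩⟩
  obtain ⟨j, hij⟩ : ∃ j, i ≠ j := (exists_ne i).imp fun _ hj ↦ hj.symm
  have hpos := h.generator_pos_of_nonconvex hnc
  exact hker i j hij (hpos i) (h.exists_aggEval_eq_zero_lt hpos hslater hij)
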